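/- Let $(E,\tau)$ be a Fréchet lattice, i.e. a real Riesz space with a linear topology that is locally convex-solid (the origin has a neighborhood basis of convex solid sets), metrizable and complete, and suppose that $E$ is $\sigma$-Dedekind complete (every nonempty countable subset that is bounded above has a supremum). Let $I$ be a $\tau$-closed ideal of $E$ (a $\tau$-closed linear subspace such that $x\in I$ and $|y|\le|x|$ imply $y\in I$). Let $w_\tau$ be the weak topology of $(E,\tau)$. Equip $I$ with the relative topologies of $w_\tau$ and $\tau$, denoted by the same symbols. Equip $E/I$ with the quotient topologies $\dot w_\tau$ and $\dot\tau$ of $w_\tau$ and $\tau$, and with the quotient order: $\dot x\le\dot y$ if and only if $x_1\le y_1$ for some $x_1\in\dot x$, $y_1\in\dot y$. For topologies $\tau_1,\tau_2$ on an ordered vector space $F$, say that $F$ has the $(\tau_1,\tau_2)$-SP (Schur property) if every $\tau_1$-null sequence in $F$ is $\tau_2$-null, and the $(\tau_1,\tau_2)$-PSP (positive Schur property) if every $\tau_1$-null sequence of positive elements ($x_n\ge 0$) of $F$ is $\tau_2$-null. If any two of the following three conditions hold, then so does the third: 1. $E$ has the $(w_\tau,\tau)$-PSP; 2. $I$ has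 the $(w_\tau,\tau)$-PSP; 3. $E/I$ has the $(\dot w_\tau,\dot\tau)$-PSP. The same is true with PSP replaced by SP in all three conditions. -/

import Mathlib

open Filter Topology

/-- A Fréchet lattice: a (real) Riesz space with a linear topology that is locally convex-solid
(the origin has a neighborhood basis of convex solid sets), metrizable and complete.
The uniform structure is the canonical one of the topological vector space, this being the meaning
of `IsUniformAddGroup`. -/
class FrechetLattice (E : Type*) [AddCommGroup E] [Lattice E] [IsOrderedAddMonoid E]
    [Module ℝ E] [IsOrderedModule ℝ E] [UniformSpace E] : Prop
    extends IsUniformAddGroup E, ContinuousSMul ℝ E, TopologicalSpace.MetrizableSpace E,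
      CompleteSpace E where
  locally_convex_solid : (𝓝 (0 : E)).HasBasis
    (fun s : Set E => s ∈ 𝓝 (0 : E) ∧ Convex ℝ s ∧ LatticeOrderedAddCommGroup.IsSolid s) id

/-- σ-Dedekind completeness: every nonempty countable subset that is bounded above has a
supremum. -/
def SigmaDedekindComplete (E : Type*) [Preorder E] : Prop :=
  ∀ s : Set E, s.Countable → s.Nonempty → BddAbove s → ∃ a, IsLUB s a

/-- The `(τ₁, τ₂)`-Schur property: `τ₁`-null sequences are `τ₂`-null. -/
def HasSP {E : Type*} [Zero E] (τ₁ τ₂ : TopologicalSpace E) : Prop :=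
  ∀ x : ℕ → E, Tendsto x atTop (@nhds E τ₁ 0) → Tendsto x atTop (@nhds E τ₂ 0)

/-- The `(τ₁, τ₂)`-positive Schur property: `τ₁`-null sequences of positive elements are
`τ₂`-null. -/
def HasPSP {E : Type*} [Zero E] [LE E] (τ₁ τ₂ : TopologicalSpace E) : Prop :=
  ∀ x : ℕ → E, (∀ n, 0 ≤ x n) →
    Tendsto x atTop (@nhds E τ₁ 0) → Tendsto x atTop (@nhds E τ₂ 0)

/-- The weak topology of `E`, as a topology on `E` itself. -/
@[reducible] noncomputable def weakTopology (E : Type*) [AddCommGroup E] [Module ℝ E] [TopologicalSpace E] :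
    TopologicalSpace E :=
  TopologicalSpace.induced (toWeakSpace ℝ E) inferInstance

/-- The relative topology on a subspace. -/
@[reducible] def relTopology {E : Type*} [AddCommGroup E] [Module ℝ E] (I : Submodule ℝ E)
    (τ : TopologicalSpace E) : TopologicalSpace I :=
  TopologicalSpace.induced (fun x : I => (x : E)) τ

/-- The quotient topology on `E ⧸ I`: the finest one for which the quotient map is continuous. -/
@[reducible] def quotTopology {E : Type*} [AddCommGroup E] [Module ℝ E] (I : Submodule ℝ E)
    (τ : TopologicalSpace E) : TopologicalSpace (E ⧸ I) :=
  TopologicalSpace.coinduced I.mkQ τ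

/-- The order of a quotient `E ⧸ I`: `a ≤ b` if some representatives `x` of `a` and `y` of `b`
satisfy `x ≤ y`. -/
instance quotientLE {E : Type*} [AddCommGroup E] [LE E] [Module ℝ E] (I : Submodule ℝ E) :
    LE (E ⧸ I) :=
  ⟨fun a b => ∃ x y : E, I.mkQ x = a ∧ I.mkQ y = b ∧ x ≤ y⟩

/-! Passing to `I` is immediate, since both topologies on `I` are relative.

Passing to `E ⧸ I` uses that PSP makes `I` a projection band. Order bounded increasing sequences
have weakly null increments, hence `τ`-null ones. So the upward directed set of elements of `I`
between `0` and `x` has a Cauchy cofinal behaviour, and its limit is its greatest element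
(`exists_greatest_le_of_hasPSP`). The projection `P` along `I` onto the disjoint complement is
positive and continuous and kills `I`, so it carries null sequences of the weak quotient topology to
weakly null sequences in `E`.

For the converse, the image of a weakly null `x n` is null for the `τ`-quotient, so it lifts to a
`τ`-null `v n`. Then `x n - v n` is weakly null in `I`, hence `τ`-null. For PSP, `x n ⊓ |v n|`
replaces `v n` to keep the difference positive. -/

open LatticeOrderedAddCommGroup

/-! ### Disjointness and projection bands in Riesz spaces -/

section RieszSpace

variable {E : Type*} [AddCommGroup E] [Lattice E]

lemma abs_smul_le_smul_abs [Module ℝ E] [IsOrderedModule ℝ E]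
    (c : ℝ) (x : E) : |c • x| ≤ |c| • |x| := by
  rcases le_total 0 c with hc | hc
  · rw [abs_of_nonneg hc]
    refine abs_le'.2 ⟨smul_le_smul_of_nonneg_left (le_abs_self x) hc, ?_⟩
    rw [← smul_neg]
    exact smul_le_smul_of_nonneg_left (neg_le_abs x) hc
  · rw [abs_of_nonpos hc]
    have hc' : 0 ≤ -c := neg_nonneg.2 hc
    refine abs_le'.2 ⟨?_, ?_⟩
    · rw [← neg_smul_neg]
      exact smul_le_smul_of_nonneg_left (neg_le_abs x) hc'
    · rw [← neg_smul]
      exact smul_le_smul_of_nonneg_left (le_abs_self x) hc'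

variable [IsOrderedAddMonoid E]

lemma add_inf_le_inf_add_inf {a b c : E} (ha : 0 ≤ a) (hb : 0 ≤ b) (hc : 0 ≤ c) :
    (a + b) ⊓ c ≤ a ⊓ c + b ⊓ c := by
  rw [add_inf, inf_add]
  refine le_inf (le_inf inf_le_left ?_) ?_
  · exact inf_le_right.trans (le_add_of_nonneg_right hb)
  · exact inf_le_right.trans (le_add_of_nonneg_left (le_inf ha hc))

lemma abs_sum_le {ι : Type*} (s : Finset ι) (f : ι → E) : |∑ i ∈ s, f i| ≤ ∑ i ∈ s, |f i| :=
  Finset.le_sum_of_subadditive (fun x : E => |x|) (by simp) abs_add_le s f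

/-- Later makes the band projection continuous: it gives `|P x| ≤ |x|`. -/
lemma abs_le_abs_add_of_inf_abs_eq_zero {a b : E} (h : |b| ⊓ |a| = 0) : |b| ≤ |a + b| := by
  have h1 : |b| ≤ |a + b| + |a| := by
    calc |b| = |(a + b) + -a| := by rw [← sub_eq_add_neg, add_sub_cancel_left]
      _ ≤ |a + b| + |a| := (abs_add_le _ _).trans_eq (by rw [abs_neg])
  calc |b| ≤ (|a + b| + |a|) ⊓ |b| := le_inf h1 le_rfl
    _ ≤ |a + b| ⊓ |b| + |a| ⊓ |b| :=
      add_inf_le_inf_add_inf (abs_nonneg _) (abs_nonneg _) (abs_nonneg _)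
    _ ≤ |a + b| := by rw [inf_comm |a|, h, add_zero]; exact inf_le_left

lemma nonneg_of_add_nonneg_of_inf_abs_eq_zero {a b : E} (h : |b| ⊓ |a| = 0) (hab : 0 ≤ a + b) :
    0 ≤ b := by
  have h1 : -b ≤ |b| ⊓ |a| :=
    le_inf (neg_le_abs b) ((neg_le_iff_add_nonneg.2 hab).trans (le_abs_self a))
  rw [h] at h1
  exact neg_nonpos.1 h1

variable [Module ℝ E] [IsOrderedModule ℝ E]

/-- The disjoint complement of a set in a Riesz space. -/
def disjointComplement (s : Set E) : Submodule ℝ E where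
  carrier := {y | ∀ z ∈ s, |y| ⊓ |z| = 0}
  zero_mem' z _ := by simp
  add_mem' {a b} ha hb z hz := by
    refine le_antisymm ?_ (le_inf (abs_nonneg _) (abs_nonneg _))
    calc |a + b| ⊓ |z| ≤ (|a| + |b|) ⊓ |z| := inf_le_inf_right _ (abs_add_le a b)
      _ ≤ |a| ⊓ |z| + |b| ⊓ |z| :=
        add_inf_le_inf_add_inf (abs_nonneg _) (abs_nonneg _) (abs_nonneg _)
      _ = 0 := by rw [ha z hz, hb z hz, add_zero]
  smul_mem' c y hy z hz := by
    have key : ∀ n : ℕ, (n • |y|) ⊓ |z| ≤ 0 := by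
      intro n
      induction n with
      | zero => simp
      | succ n ih =>
        rw [succ_nsmul]
        calc (n • |y| + |y|) ⊓ |z| ≤ (n • |y|) ⊓ |z| + |y| ⊓ |z| :=
              add_inf_le_inf_add_inf (nsmul_nonneg (abs_nonneg _) n) (abs_nonneg _) (abs_nonneg _)
          _ ≤ 0 := by rw [hy z hz, add_zero]; exact ih
    obtain ⟨n, hn⟩ := exists_nat_ge |c|
    refine le_antisymm ((inf_le_inf_right _ ?_).trans (key n)) (le_inf (abs_nonneg _) (abs_nonneg _))
    calc |c • y| ≤ |c| • |y| := abs_smul_le_smul_abs c y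
      _ ≤ (n : ℝ) • |y| := smul_le_smul_of_nonneg_right hn (abs_nonneg y)
      _ = n • |y| := Nat.cast_smul_eq_nsmul ℝ n |y|

lemma mem_disjointComplement {s : Set E} {y : E} :
    y ∈ disjointComplement s ↔ ∀ z ∈ s, |y| ⊓ |z| = 0 := Iff.rfl

lemma disjoint_disjointComplement (I : Submodule ℝ E) :
    Disjoint I (disjointComplement (I : Set E)) := by
  rw [Submodule.disjoint_def]
  intro x hx hx'
  have h := hx' x hx
  rw [inf_idem] at h
  exact le_antisymm (h ▸ le_abs_self x) (neg_nonpos.1 (h ▸ neg_le_abs x))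

/-- If every positive element dominates a largest positive element of the ideal `I`, then `I` is
a projection band. -/
lemma isCompl_disjointComplement {I : Submodule ℝ E} (hI : IsSolid (I : Set E))
    (h : ∀ x : E, 0 ≤ x → ∃ p ∈ I, p ≤ x ∧ ∀ z ∈ I, 0 ≤ z → z ≤ x → z ≤ p) :
    IsCompl I (disjointComplement (I : Set E)) := by
  refine ⟨disjoint_disjointComplement I, codisjoint_iff.2 (eq_top_iff.2 fun x _ => ?_)⟩
  have pos : ∀ x : E, 0 ≤ x → x ∈ I ⊔ disjointComplement (I : Set E) := by
    intro x hx
    obtain ⟨p, hpI, hpx, hp⟩ := h x hx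
    have hp0 : 0 ≤ p := hp 0 I.zero_mem le_rfl hx
    refine Submodule.mem_sup.2 ⟨p, hpI, x - p, fun z hz => ?_, add_sub_cancel p x⟩
    rw [abs_of_nonneg (sub_nonneg.2 hpx)]
    have hw0 : 0 ≤ (x - p) ⊓ |z| := le_inf (sub_nonneg.2 hpx) (abs_nonneg z)
    have hwI : (x - p) ⊓ |z| ∈ I := hI hz (by rw [abs_of_nonneg hw0]; exact inf_le_right)
    -- Maximality of `p`: the common part of `x - p` and `|z|` could be added to it.
    have : p + (x - p) ⊓ |z| ≤ p := by
      refine hp _ (I.add_mem hpI hwI) (add_nonneg hp0 hw0) ?_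
      calc p + (x - p) ⊓ |z| ≤ p + (x - p) := by gcongr; exact inf_le_left
        _ = x := add_sub_cancel p x
    exact le_antisymm (by simpa using this) hw0
  rw [← posPart_sub_negPart x]
  exact Submodule.sub_mem _ (pos _ (posPart_nonneg x)) (pos _ (negPart_nonneg x))

end RieszSpace

/-! ### Weakly null increments and the band projection -/

section FrechetLattice

variable {E : Type*} [AddCommGroup E] [Lattice E] [IsOrderedAddMonoid E]
  [Module ℝ E] [IsOrderedModule ℝ E] [τ : UniformSpace E] [FrechetLattice E]

lemma FrechetLattice.exists_solid_subset {U : Set E} (hU : U ∈ 𝓝 (0 : E)) :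
    ∃ V ∈ 𝓝 (0 : E), IsSolid V ∧ V ⊆ U := by
  obtain ⟨V, ⟨hV, -, hs⟩, hVU⟩ := FrechetLattice.locally_convex_solid.mem_iff.1 hU
  exact ⟨V, hV, hs, hVU⟩

lemma FrechetLattice.tendsto_zero_of_abs_le {ι : Type*} {l : Filter ι} {u v : ι → E}
    (hv : Tendsto v l (𝓝 0)) (h : ∀ᶠ n in l, |u n| ≤ |v n|) : Tendsto u l (𝓝 0) := by
  intro U hU
  obtain ⟨V, hV, hs, hVU⟩ := exists_solid_subset hU
  exact ((hv.eventually_mem hV).and h).mono fun n hn => hVU (hs hn.1 hn.2)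

/-- The constant `c⁺` is dominated by `|v n|`, so it tends to zero and vanishes by the Hausdorff
property. -/
lemma FrechetLattice.nonpos_of_tendsto_zero {ι : Type*} {l : Filter ι} [l.NeBot] {c : E}
    {v : ι → E} (hv : Tendsto v l (𝓝 0)) (h : ∀ᶠ n in l, c ≤ v n) : c ≤ 0 := by
  have h1 : Tendsto (fun _ : ι => c⁺) l (𝓝 0) := by
    refine tendsto_zero_of_abs_le hv (h.mono fun n hn => ?_)
    rw [abs_of_nonneg (posPart_nonneg c)]
    exact sup_le (hn.trans (le_abs_self _)) (abs_nonneg _)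
  exact posPart_eq_zero.1 (tendsto_nhds_unique tendsto_const_nhds h1)

lemma FrechetLattice.exists_bound_of_abs_le (f : E →L[ℝ] ℝ) (x : E) :
    ∃ C : ℝ, ∀ w : E, |w| ≤ x → |f w| ≤ C := by
  have hf : f ⁻¹' Metric.ball 0 1 ∈ 𝓝 (0 : E) :=
    f.continuous.continuousAt.preimage_mem_nhds (by simpa using Metric.ball_mem_nhds (0 : ℝ) one_pos)
  obtain ⟨V, hV, hs, hVf⟩ := exists_solid_subset hf
  have hx : Tendsto (fun c : ℝ => c • x) (𝓝[>] 0) (𝓝 0) := by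
    have : Tendsto (fun c : ℝ => c • x) (𝓝 0) (𝓝 ((0 : ℝ) • x)) :=
      (continuous_id.smul continuous_const).tendsto 0
    rw [zero_smul] at this
    exact this.mono_left nhdsWithin_le_nhds
  obtain ⟨c, hcV, hc⟩ := ((hx.eventually_mem hV).and self_mem_nhdsWithin).exists
  have hc : 0 < c := hc
  refine ⟨1 / c, fun w hw => ?_⟩
  have hcw : c • w ∈ V := by
    refine hs hcV ((abs_smul_le_smul_abs c w).trans ?_)
    rw [abs_of_pos hc]
    exact (smul_le_smul_of_nonneg_left hw hc.le).trans (le_abs_self _)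
  have h1 : |f (c • w)| < 1 := by simpa using hVf hcw
  rw [map_smul, smul_eq_mul, abs_mul, abs_of_pos hc] at h1
  rw [le_div_iff₀ hc, mul_comm]
  exact h1.le

lemma weakTopology_eq_induced (F : Type*) [AddCommGroup F] [Module ℝ F] [TopologicalSpace F] :
    weakTopology F = TopologicalSpace.induced (fun x (f : F →L[ℝ] ℝ) => f x) Pi.topologicalSpace := by
  change TopologicalSpace.induced (toWeakSpace ℝ F) (TopologicalSpace.induced
    (fun (x : WeakSpace ℝ F) (f : F →L[ℝ] ℝ) => (topDualPairing ℝ F).flip x f)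
      Pi.topologicalSpace) = _
  rw [induced_compose]
  rfl

lemma tendsto_weakTopology_iff {F ι : Type*} [AddCommGroup F] [Module ℝ F] [TopologicalSpace F]
    {l : Filter ι} {u : ι → F} :
    Tendsto u l (@nhds F (weakTopology F) 0) ↔
      ∀ f : F →L[ℝ] ℝ, Tendsto (fun n => f (u n)) l (𝓝 0) := by
  rw [weakTopology_eq_induced, nhds_induced, tendsto_comap_iff, tendsto_pi_nhds]
  simp only [map_zero, Function.comp_def]

/-- Increments of an order bounded monotone sequence are weakly null. -/
lemma FrechetLattice.tendsto_sub_weakTopology {y : ℕ → E} (hy : Monotone y) {x : E}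
    (hx : ∀ n, y n ≤ x) :
    Tendsto (fun n => y (n + 1) - y n) atTop (@nhds E (weakTopology E) 0) := by
  refine tendsto_weakTopology_iff.2 fun f => ?_
  obtain ⟨C, hC⟩ := exists_bound_of_abs_le f (x - y 0)
  have hz : ∀ n, 0 ≤ y (n + 1) - y n := fun n => sub_nonneg.2 (hy n.le_succ)
  have hsum : Summable fun n => |f (y (n + 1) - y n)| := by
    refine summable_of_sum_range_le (c := C) (fun n => abs_nonneg _) fun n => ?_
    -- Signs turn the sum of absolute values into `f` of one signed sum, whose modulus is at most
    -- the telescoping sum.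
    have hsign : ∀ a : ℝ, ∃ e : ℝ, |e| ≤ 1 ∧ |a| = e * a := fun a => by
      rcases abs_choice a with h | h
      · exact ⟨1, by simp, by rw [h, one_mul]⟩
      · exact ⟨-1, by simp, by rw [h, neg_one_mul]⟩
    choose ε hε hεa using fun k => hsign (f (y (k + 1) - y k))
    have h1 : ∑ k ∈ Finset.range n, |f (y (k + 1) - y k)| =
        f (∑ k ∈ Finset.range n, ε k • (y (k + 1) - y k)) := by
      rw [map_sum]
      refine Finset.sum_congr rfl fun k _ => ?_
      rw [map_smul, smul_eq_mul, ← hεa]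
    rw [h1]
    refine (le_abs_self _).trans (hC _ ?_)
    calc |∑ k ∈ Finset.range n, ε k • (y (k + 1) - y k)|
        ≤ ∑ k ∈ Finset.range n, |ε k • (y (k + 1) - y k)| := abs_sum_le _ _
      _ ≤ ∑ k ∈ Finset.range n, (y (k + 1) - y k) := by
        refine Finset.sum_le_sum fun k _ => (abs_smul_le_smul_abs _ _).trans ?_
        rw [abs_of_nonneg (hz k)]
        exact (smul_le_smul_of_nonneg_right (hε k) (hz k)).trans_eq (one_smul ℝ _)
      _ = y n - y 0 := Finset.sum_range_sub y n
      _ ≤ x - y 0 := sub_le_sub_right (hx n) _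
  exact (tendsto_zero_iff_abs_tendsto_zero _).2 hsum.tendsto_atTop_zero

/-- Under the positive Schur property, every positive element dominates a largest positive element
of a given closed ideal. -/
lemma FrechetLattice.exists_greatest_le_of_hasPSP
    (hE : HasPSP (weakTopology E) τ.toTopologicalSpace) {I : Submodule ℝ E}
    (hI : IsSolid (I : Set E)) (hIc : IsClosed (I : Set E)) {x : E} (hx : 0 ≤ x) :
    ∃ p ∈ I, p ≤ x ∧ ∀ z ∈ I, 0 ≤ z → z ≤ x → z ≤ p := by
  let D : Set E := {y | y ∈ I ∧ 0 ≤ y ∧ y ≤ x}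
  have hDsup : ∀ a ∈ D, ∀ b ∈ D, a ⊔ b ∈ D := by
    rintro a ⟨ha, ha0, hax⟩ b ⟨hb, hb0, hbx⟩
    refine ⟨hI (I.add_mem ha hb) ?_, ha0.trans le_sup_left, sup_le hax hbx⟩
    rw [abs_of_nonneg (ha0.trans le_sup_left), abs_of_nonneg (add_nonneg ha0 hb0)]
    exact sup_le (le_add_of_nonneg_right hb0) (le_add_of_nonneg_left ha0)
  -- Otherwise iteration from `0` yields an increasing sequence in `D` whose increments all avoid
  -- `U`, against PSP.
  have good : ∀ U ∈ 𝓝 (0 : E), ∃ d ∈ D, ∀ z ∈ D, d ≤ z → z - d ∈ U := by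
    intro U hU
    by_contra! H
    choose! g hgD hg hgU using H
    let y : ℕ → E := fun n => g^[n] 0
    have hyD : ∀ n, y n ∈ D := by
      intro n
      induction n with
      | zero => exact ⟨I.zero_mem, le_rfl, hx⟩
      | succ n ih => simpa [y, Function.iterate_succ_apply'] using hgD _ ih
    have hys : ∀ n, y (n + 1) = g (y n) := fun n => Function.iterate_succ_apply' g n 0
    have hym : Monotone y := monotone_nat_of_le_succ fun n => by
      rw [hys]; exact hg _ (hyD n)
    have := hE _ (fun n => sub_nonneg.2 (hym n.le_succ))
      (tendsto_sub_weakTopology hym fun n => (hyD n).2.2)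
    obtain ⟨n, hn⟩ := (this.eventually_mem hU).exists
    refine hgU _ (hyD n) ?_
    rw [← hys]
    exact hn
  obtain ⟨U, hU, hUb⟩ :=
    (FrechetLattice.locally_convex_solid (E := E)).exists_antitone_subbasis
  choose d hdD hd using fun n => good (U n) (hU n).1
  let y : ℕ → E := partialSups d
  have hyD : ∀ n, y n ∈ D := by
    intro n
    induction n with
    | zero => simpa [y] using hdD 0
    | succ n ih =>
      simp only [y, partialSups_add_one]
      exact hDsup _ ih _ (hdD _)
  have hym : Monotone y := (partialSups d).monotone
  have hyU : ∀ n, ∀ z ∈ D, y n ≤ z → z - y n ∈ U n := by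
    intro n z hz hyz
    have hdy : d n ≤ y n := le_partialSups d n
    refine (hU n).2.2 (hd n z hz (hdy.trans hyz)) ?_
    rw [abs_of_nonneg (sub_nonneg.2 hyz), abs_of_nonneg (sub_nonneg.2 (hdy.trans hyz))]
    exact sub_le_sub_left hdy z
  have hcau : CauchySeq y := by
    rw [hUb.1.uniformity_of_nhds_zero_swapped.cauchySeq_iff']
    exact fun k _ => ⟨k, fun n hn => hyU k _ (hyD n) (hym hn)⟩
  obtain ⟨p, hp⟩ := cauchySeq_tendsto_of_complete hcau
  have hp1 : Tendsto (fun n => p - y n) atTop (𝓝 0) := by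
    simpa using (tendsto_const_nhds (x := p)).sub hp
  have hp2 : Tendsto (fun n => y n - p) atTop (𝓝 0) := by
    simpa using hp.sub (tendsto_const_nhds (x := p))
  refine ⟨p, hIc.mem_of_tendsto hp (Eventually.of_forall fun n => (hyD n).1), ?_, ?_⟩
  · exact sub_nonpos.1 (nonpos_of_tendsto_zero hp1
      (Eventually.of_forall fun n => sub_le_sub_left (hyD n).2.2 p))
  · intro z hz hz0 hzx
    -- Both `y n ⊔ z` and `y n` lie in `D`, so `z - p` is dominated by a null sequence.
    have h1 : Tendsto (fun n => y n ⊔ z - y n) atTop (𝓝 0) := by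
      refine hUb.1.tendsto_right_iff.2 fun k _ => ?_
      filter_upwards [eventually_ge_atTop k] with n hn
      exact hUb.antitone hn (hyU n _ (hDsup _ (hyD n) _ ⟨hz, hz0, hzx⟩) le_sup_left)
    have h2 : Tendsto (fun n => (y n ⊔ z - y n) + (y n - p)) atTop (𝓝 0) := by
      simpa only [add_zero] using h1.add hp2
    refine sub_nonpos.1 (nonpos_of_tendsto_zero h2 (Eventually.of_forall fun n => ?_))
    rw [sub_add_sub_cancel]
    exact sub_le_sub_right le_sup_right p

/-- Under the positive Schur property, a closed ideal is the kernel of a positive continuous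
projection. -/
lemma FrechetLattice.exists_projection_of_hasPSP
    (hE : HasPSP (weakTopology E) τ.toTopologicalSpace) {I : Submodule ℝ E}
    (hI : IsSolid (I : Set E)) (hIc : IsClosed (I : Set E)) :
    ∃ P : E →L[ℝ] E, (∀ x ∈ I, P x = 0) ∧ (∀ x, x - P x ∈ I) ∧ ∀ x, 0 ≤ x → 0 ≤ P x := by
  have hc := isCompl_disjointComplement hI fun x hx => exists_greatest_le_of_hasPSP hE hI hIc hx
  let P : E →ₗ[ℝ] E := Submodule.projection _ I hc.symm
  have hPI : ∀ x, x - P x ∈ I := Submodule.sub_projection_mem hc.symm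
  have hdisj : ∀ x, |P x| ⊓ |x - P x| = 0 := fun x =>
    mem_disjointComplement.1 (Submodule.projection_apply_mem hc.symm x) _ (hPI x)
  have hP : Continuous P := by
    refine continuous_of_continuousAt_zero P.toAddMonoidHom ?_
    change Tendsto P (𝓝 0) (𝓝 (P 0))
    rw [map_zero]
    refine tendsto_zero_of_abs_le tendsto_id (Eventually.of_forall fun x => ?_)
    simpa using abs_le_abs_add_of_inf_abs_eq_zero (hdisj x)
  refine ⟨⟨P, hP⟩, fun x hx => (Submodule.projection_apply_eq_zero_iff hc.symm).2 hx, hPI, ?_⟩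
  intro x hx
  exact nonneg_of_add_nonneg_of_inf_abs_eq_zero (hdisj x) (by simpa using hx)

end FrechetLattice

/-! ### Null sequences in subspaces and quotients -/

section Quotient

variable {E : Type*} [AddCommGroup E] [Module ℝ E]

lemma HasSP.hasPSP {E : Type*} [Zero E] [LE E] {τ₁ τ₂ : TopologicalSpace E} (h : HasSP τ₁ τ₂) :
    HasPSP τ₁ τ₂ := fun _ _ hx => h _ hx

lemma tendsto_relTopology_iff {I : Submodule ℝ E} {t : TopologicalSpace E} {ι : Type*}
    {l : Filter ι} {u : ι → I} :
    Tendsto u l (@nhds I (relTopology I t) 0) ↔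
      Tendsto (fun n => (u n : E)) l (@nhds E t 0) := by
  rw [nhds_induced, tendsto_comap_iff]
  rfl

lemma HasSP.restrict {τ₁ τ₂ : TopologicalSpace E} (h : HasSP τ₁ τ₂) (I : Submodule ℝ E) :
    HasSP (relTopology I τ₁) (relTopology I τ₂) := fun _ hx =>
  tendsto_relTopology_iff.2 (h _ (tendsto_relTopology_iff.1 hx))

lemma HasPSP.restrict [LE E] {τ₁ τ₂ : TopologicalSpace E} (h : HasPSP τ₁ τ₂)
    (I : Submodule ℝ E) : HasPSP (relTopology I τ₁) (relTopology I τ₂) := fun _ h0 hx =>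
  tendsto_relTopology_iff.2 (h _ h0 (tendsto_relTopology_iff.1 hx))

lemma tendsto_mkQ_quotTopology (I : Submodule ℝ E) (t : TopologicalSpace E) {ι : Type*}
    {l : Filter ι} {u : ι → E} (hu : Tendsto u l (@nhds E t 0)) :
    Tendsto (fun n => I.mkQ (u n)) l (@nhds (E ⧸ I) (quotTopology I t) 0) := by
  let := quotTopology I t
  have : Continuous I.mkQ := continuous_coinduced_rng
  have h := (this.tendsto 0).comp hu
  rwa [map_zero] at h

lemma nhds_quotTopology_zero (I : Submodule ℝ E) [t : TopologicalSpace E] [ContinuousAdd E] :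
    @nhds (E ⧸ I) (quotTopology I t) 0 = map I.mkQ (𝓝 0) := by
  have h := (Submodule.isOpenMap_mkQ I).map_nhds_eq (I.continuous_mkQ.continuousAt (x := 0))
  rw [map_zero] at h
  exact h.symm

lemma continuous_weakTopology_map {F G : Type*} [AddCommGroup F] [Module ℝ F] [TopologicalSpace F]
    [AddCommGroup G] [Module ℝ G] [TopologicalSpace G] (f : F →L[ℝ] G) :
    @Continuous F G (weakTopology F) (weakTopology G) f := by
  have h : @Continuous F (WeakSpace ℝ G) (weakTopology F) _
      (WeakSpace.map f ∘ toWeakSpace ℝ F) :=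
    @Continuous.comp F (WeakSpace ℝ F) (WeakSpace ℝ G) (weakTopology F) _ _ _ _
      (WeakSpace.map f).continuous continuous_induced_dom
  exact continuous_induced_rng.2 h

/-- A sequence converging along the image of a countably generated filter lifts. -/
lemma Filter.Tendsto.exists_lift {α β : Type*} {l : Filter α} [l.IsCountablyGenerated] {π : α → β}
    (hπ : Function.Surjective π) {u : ℕ → β} (hu : Tendsto u atTop (map π l)) :
    ∃ v : ℕ → α, Tendsto v atTop l ∧ ∀ n, π (v n) = u n := by
  classical
  obtain ⟨U, hU⟩ := l.exists_antitone_basis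
  -- The preimage is taken in the smallest `U k`, `k ≤ n`, whose image contains `u n`, and
  -- arbitrarily if there is none.
  have hv : ∀ n, ∃ a, π a = u n ∧
      ((∃ k ≤ n, u n ∈ π '' U k) → a ∈ U (Nat.findGreatest (fun k => u n ∈ π '' U k) n)) := by
    intro n
    by_cases h : ∃ k ≤ n, u n ∈ π '' U k
    · obtain ⟨k, hk, hku⟩ := h
      obtain ⟨a, ha, hau⟩ := Nat.findGreatest_spec (P := fun k => u n ∈ π '' U k) hk hku
      exact ⟨a, hau, fun _ => ha⟩
    · obtain ⟨a, ha⟩ := hπ (u n)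
      exact ⟨a, ha, fun h' => absurd h' h⟩
  choose v hvu hvU using hv
  refine ⟨v, hU.1.tendsto_right_iff.2 fun k _ => ?_, hvu⟩
  filter_upwards [eventually_ge_atTop k, hu (image_mem_map (hU.1.mem_of_mem trivial : U k ∈ l))]
    with n hkn hn
  exact hU.antitone (Nat.le_findGreatest hkn hn) (hvU n ⟨k, hkn, hn⟩)

lemma exists_lift_quotTopology (I : Submodule ℝ E) [t : TopologicalSpace E] [ContinuousAdd E]
    [FirstCountableTopology E] {u : ℕ → E}
    (hu : Tendsto (fun n => I.mkQ (u n)) atTop (@nhds (E ⧸ I) (quotTopology I t) 0)) :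
    ∃ v : ℕ → E, Tendsto v atTop (𝓝 0) ∧ ∀ n, u n - v n ∈ I := by
  rw [nhds_quotTopology_zero] at hu
  obtain ⟨v, hv, h⟩ := hu.exists_lift I.mkQ_surjective
  exact ⟨v, hv, fun n => (Submodule.Quotient.eq I).1 (h n).symm⟩

/-- Applying a continuous linear map that vanishes on `I` to representatives of a null sequence for
the quotient of the weak topology yields a weakly null sequence. -/
lemma tendsto_weakTopology_of_quotTopology [TopologicalSpace E] {I : Submodule ℝ E} {P : E →L[ℝ] E}
    (hP : ∀ x ∈ I, P x = 0) {ι : Type*} {l : Filter ι} {u : ι → E}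
    (hu : Tendsto (fun n => I.mkQ (u n)) l (@nhds (E ⧸ I) (quotTopology I (weakTopology E)) 0)) :
    Tendsto (fun n => P (u n)) l (@nhds E (weakTopology E) 0) := by
  let L : E ⧸ I →ₗ[ℝ] E := I.liftQ P.toLinearMap fun x hx => hP x hx
  have hL : @Continuous _ _ (quotTopology I (weakTopology E)) (weakTopology E) L :=
    (@continuous_coinduced_dom _ _ _ _ _ (weakTopology E) (weakTopology E)).2
      (continuous_weakTopology_map P)
  have h := (@Continuous.tendsto _ _ (quotTopology I (weakTopology E)) (weakTopology E) _ hL 0).comp hu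
  rwa [map_zero] at h

lemma tendsto_weakTopology_of_tendsto [TopologicalSpace E] {ι : Type*} {l : Filter ι} {u : ι → E}
    (hu : Tendsto u l (𝓝 0)) : Tendsto u l (@nhds E (weakTopology E) 0) :=
  tendsto_weakTopology_iff.2 fun f => by
    simpa [Function.comp_def] using (f.continuous.tendsto 0).comp hu

lemma tendsto_sub_weakTopology [TopologicalSpace E] {ι : Type*} {l : Filter ι} {u v : ι → E}
    (hu : Tendsto u l (@nhds E (weakTopology E) 0)) (hv : Tendsto v l (𝓝 0)) :
    Tendsto (fun n => u n - v n) l (@nhds E (weakTopology E) 0) :=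
  tendsto_weakTopology_iff.2 fun f => by
    simpa using (tendsto_weakTopology_iff.1 hu f).sub
      (tendsto_weakTopology_iff.1 (tendsto_weakTopology_of_tendsto hv) f)

lemma tendsto_mkQ_of_projection [t : TopologicalSpace E] {I : Submodule ℝ E} {P : E →L[ℝ] E} (hPI : ∀ x, x - P x ∈ I) {u : ℕ → E}
    (hu : Tendsto (fun n => P (u n)) atTop (𝓝 0)) :
    Tendsto (fun n => I.mkQ (u n)) atTop
      (@nhds (E ⧸ I) (quotTopology I t) 0) := by
  have h : ∀ n, I.mkQ (u n) = I.mkQ (P (u n)) := fun n => (Submodule.Quotient.eq I).2 (hPI _)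
  simp_rw [h]
  exact tendsto_mkQ_quotTopology I _ hu

end Quotient

/-! ### Transfer of the Schur properties -/

section SchurProperty

variable {E : Type*} [AddCommGroup E] [Lattice E] [IsOrderedAddMonoid E]
  [Module ℝ E] [IsOrderedModule ℝ E] [τ : UniformSpace E] [FrechetLattice E] {I : Submodule ℝ E}

lemma HasSP.quotient (hI : IsSolid (I : Set E)) (hIc : IsClosed (I : Set E))
    (hE : HasSP (weakTopology E) τ.toTopologicalSpace) :
    HasSP (quotTopology I (weakTopology E)) (quotTopology I τ.toTopologicalSpace) := by
  obtain ⟨P, hP, hPI, -⟩ := FrechetLattice.exists_projection_of_hasPSP hE.hasPSP hI hIc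
  intro x hx
  choose u hu using fun n => I.mkQ_surjective (x n)
  obtain rfl : (fun n => I.mkQ (u n)) = x := funext hu
  exact tendsto_mkQ_of_projection hPI (hE _ (tendsto_weakTopology_of_quotTopology hP hx))

lemma HasPSP.quotient (hI : IsSolid (I : Set E)) (hIc : IsClosed (I : Set E))
    (hE : HasPSP (weakTopology E) τ.toTopologicalSpace) :
    HasPSP (quotTopology I (weakTopology E)) (quotTopology I τ.toTopologicalSpace) := by
  obtain ⟨P, hP, hPI, hPpos⟩ := FrechetLattice.exists_projection_of_hasPSP hE hI hIc
  intro x h0 hx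
  choose a u ha hu hau using h0
  obtain rfl : (fun n => I.mkQ (u n)) = x := funext hu
  refine tendsto_mkQ_of_projection hPI (hE _ (fun n => ?_)
    (tendsto_weakTopology_of_quotTopology hP hx))
  -- Positivity in the quotient means `a n ≤ u n` with `a n ∈ I`; applying `P` removes `a n`.
  have h1 : P (a n) = 0 := hP _ ((Submodule.Quotient.mk_eq_zero I).1 (ha n))
  have h2 := hPpos _ (sub_nonneg.2 (hau n))
  rwa [map_sub, h1, sub_zero] at h2

lemma HasSP.of_restrict_of_quotient
    (hI : HasSP (relTopology I (weakTopology E)) (relTopology I τ.toTopologicalSpace))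
    (hQ : HasSP (quotTopology I (weakTopology E)) (quotTopology I τ.toTopologicalSpace)) :
    HasSP (weakTopology E) τ.toTopologicalSpace := by
  intro x hx
  obtain ⟨v, hv, hvI⟩ := exists_lift_quotTopology I (hQ _ (tendsto_mkQ_quotTopology I _ hx))
  have h := tendsto_relTopology_iff.1 (hI (fun n => ⟨x n - v n, hvI n⟩)
    (tendsto_relTopology_iff.2 (tendsto_sub_weakTopology hx hv)))
  simpa using h.add hv

lemma HasPSP.of_restrict_of_quotient (hs : IsSolid (I : Set E))
    (hI : HasPSP (relTopology I (weakTopology E)) (relTopology I τ.toTopologicalSpace))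
    (hQ : HasPSP (quotTopology I (weakTopology E)) (quotTopology I τ.toTopologicalSpace)) :
    HasPSP (weakTopology E) τ.toTopologicalSpace := by
  intro x h0 hx
  obtain ⟨v, hv, hvI⟩ := exists_lift_quotTopology I
    (hQ _ (fun n => ⟨0, x n, map_zero _, rfl, h0 n⟩) (tendsto_mkQ_quotTopology I _ hx))
  have hw : Tendsto (fun n => x n ⊓ |v n|) atTop (𝓝 0) := by
    refine FrechetLattice.tendsto_zero_of_abs_le hv (Eventually.of_forall fun n => ?_)
    rw [abs_of_nonneg (le_inf (h0 n) (abs_nonneg _))]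
    exact inf_le_right
  have hpos : ∀ n, 0 ≤ x n - x n ⊓ |v n| := fun n => sub_nonneg.2 inf_le_left
  -- The difference is `(x n - |v n|)⁺`, which is at most `|x n - v n|`, and `I` is solid.
  have hwI : ∀ n, x n - x n ⊓ |v n| ∈ I := fun n => by
    refine hs (hvI n) ?_
    rw [abs_of_nonneg (hpos n), sub_inf, sub_self]
    exact sup_le (abs_nonneg _) ((sub_le_sub_left (le_abs_self _) _).trans (le_abs_self _))
  have h := tendsto_relTopology_iff.1 (hI (fun n => ⟨x n - x n ⊓ |v n|, hwI n⟩) hpos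
    (tendsto_relTopology_iff.2 (tendsto_sub_weakTopology hx hw)))
  simpa using h.add hw

end SchurProperty

theorem corollary2p4 {E : Type*} [AddCommGroup E] [Lattice E] [IsOrderedAddMonoid E]
    [Module ℝ E] [IsOrderedModule ℝ E] [τ : UniformSpace E] [FrechetLattice E]
    (hE : SigmaDedekindComplete E) (I : Submodule ℝ E)
    (hI_ideal : LatticeOrderedAddCommGroup.IsSolid (I : Set E))
    (hI_closed : IsClosed (I : Set E)) :
    ((HasPSP (weakTopology E) τ.toTopologicalSpace →
      HasPSP (relTopology I (weakTopology E)) (relTopology I τ.toTopologicalSpace) →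
      HasPSP (quotTopology I (weakTopology E)) (quotTopology I τ.toTopologicalSpace)) ∧
    (HasPSP (weakTopology E) τ.toTopologicalSpace →
      HasPSP (quotTopology I (weakTopology E)) (quotTopology I τ.toTopologicalSpace) →
      HasPSP (relTopology I (weakTopology E)) (relTopology I τ.toTopologicalSpace)) ∧
    (HasPSP (relTopology I (weakTopology E)) (relTopology I τ.toTopologicalSpace) →
      HasPSP (quotTopology I (weakTopology E)) (quotTopology I τ.toTopologicalSpace) →
      HasPSP (weakTopology E) τ.toTopologicalSpace)) ∧
    ((HasSP (weakTopology E) τ.toTopologicalSpace →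
      HasSP (relTopology I (weakTopology E)) (relTopology I τ.toTopologicalSpace) →
      HasSP (quotTopology I (weakTopology E)) (quotTopology I τ.toTopologicalSpace)) ∧
    (HasSP (weakTopology E) τ.toTopologicalSpace →
      HasSP (quotTopology I (weakTopology E)) (quotTopology I τ.toTopologicalSpace) →
      HasSP (relTopology I (weakTopology E)) (relTopology I τ.toTopologicalSpace)) ∧
    (HasSP (relTopology I (weakTopology E)) (relTopology I τ.toTopologicalSpace) →
      HasSP (quotTopology I (weakTopology E)) (quotTopology I τ.toTopologicalSpace) →
      HasSP (weakTopology E) τ.toTopologicalSpace)) := by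
  exact ⟨⟨fun h _ => h.quotient hI_ideal hI_closed, fun h _ => h.restrict I,
      HasPSP.of_restrict_of_quotient hI_ideal⟩,
    fun h _ => h.quotient hI_ideal hI_closed, fun h _ => h.restrict I,
    HasSP.of_restrict_of_quotient⟩
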